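/- Let $d\ge 2$ be an integer and, for $x\in(0,\infty)$, let $$V(x)=\frac{x^{2-d}-1}{d-2}+\frac{x^2-1}{2},$$ where the first term is replaced by $-\ln x$ when $d=2$. For every $E>0$ the equation $V(x)=E$ has exactly two solutions $x_1(E)<x_2(E)$ in $(0,\infty)$, and the integral $$T(E)=2\int_{x_1(E)}^{x_2(E)}\frac{\mathrm{d}x}{\sqrt{2\,(E-V(x))}},$$ which gives the period at energy level $E=\tfrac12v^2+V(x)$ of the Hamiltonian system $\dot x=v$, $\dot v=-V'(x)$, converges. The period function $T$ is non-constant on every non-degenerate sub-interval of $(0,\infty)$ if and only if $d\ne4$. Furthermore, if $d=4$, then $T(E)=\pi$ for all $E>0$. -/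

import Mathlib

open Set MeasureTheory

noncomputable section

/-- The potential `V(x) = (x^(2-d) - 1)/(d - 2) + (x^2 - 1)/2`, considered on `(0, ∞)`, where the
first term is replaced by `-ln x` when `d = 2`. -/
def potential (d : ℕ) (x : ℝ) : ℝ :=
  (if d = 2 then -Real.log x else (x ^ (2 - (d : ℤ)) - 1) / ((d : ℝ) - 2)) + (x ^ 2 - 1) / 2

/-- The set of the points of the domain `D` where the potential `V` takes the value `E`. -/
def turningPoints (V : ℝ → ℝ) (D : Set ℝ) (E : ℝ) : Set ℝ := {x | x ∈ D ∧ V x = E}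

/-- The left turning point `x₁(E)` of an orbit of energy `E`. -/
def leftTurningPoint (V : ℝ → ℝ) (D : Set ℝ) (E : ℝ) : ℝ := sInf (turningPoints V D E)

/-- The right turning point `x₂(E)` of an orbit of energy `E`. -/
def rightTurningPoint (V : ℝ → ℝ) (D : Set ℝ) (E : ℝ) : ℝ := sSup (turningPoints V D E)

/-- The period `T(E)` at energy level `E` of the Hamiltonian system `x' = v`, `v' = -V'(x)` on the
interval `D`, given by `T(E) / 2 = ∫ dx / √(2 (E - V(x)))` over `x₁(E) ≤ x ≤ x₂(E)`. -/
def period (V : ℝ → ℝ) (D : Set ℝ) (E : ℝ) : ℝ :=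
  2 * ∫ x in leftTurningPoint V D E..rightTurningPoint V D E, 1 / Real.sqrt (2 * (E - V x))

/-- `T` is non-constant on every (non-degenerate) sub-interval of `S`: intervals may be open,
closed, half-open, bounded or unbounded. -/
def NonconstantOnSubintervals (T : ℝ → ℝ) (S : Set ℝ) : Prop :=
  ∀ I : Set ℝ, I ⊆ S → I.OrdConnected → I.Nontrivial → ∃ E₁ ∈ I, ∃ E₂ ∈ I, T E₁ ≠ T E₂

end

/-! In the coordinate `y = ln x` the potential is an analytic function `W` with a non-degenerate
minimum at `0`. Its signed square root `h` is an analytic coordinate on the whole line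
(`exists_analytic_sqrt`, `exists_analytic_inverse`), so `x = X(h)` with `V(X(h)) = h²`. Substituting
`x = X(r sin θ)` turns the period into `T(r²) = √2 ∫ X'(r sin θ) dθ` over `[-π/2, π/2]`.

The right side makes sense and is analytic for every real `r` (`analyticAt_integral_comp_mul`). If
`T` is constant on some interval, the right side is therefore constant on the line. At `r = 0` it
equals `2π/√d`, by the second derivative of `W` at the minimum. As `r → ∞` it tends to `π`, since
`X' → √2` at `+∞` and `X' → 0` at `-∞`. Equality forces `d = 4`.

For `d = 4`, `W = 2 sinh² y`, so `X' - 1/√2` is odd and only the constant `1/√2` survives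
integration. -/

open Filter Topology

/-! ### Analytic dependence of an integral on a parameter -/

/-- Integration over `[a, b]` as a continuous linear functional on `C([a, b], ℝ)`. -/
noncomputable def integralIccCLM {a b : ℝ} (hab : a ≤ b) : C(Icc a b, ℝ) →L[ℝ] ℝ :=
  LinearMap.mkContinuous
    { toFun := fun g => ∫ θ in a..b, IccExtend hab g θ
      map_add' := fun g h => by
        rw [← intervalIntegral.integral_add
          ((g.continuous.Icc_extend' (h := hab)).intervalIntegrable a b)
          ((h.continuous.Icc_extend' (h := hab)).intervalIntegrable a b)]
        rfl
      map_smul' := fun c g => by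
        simp only [RingHom.id_apply]
        rw [← intervalIntegral.integral_smul]
        rfl }
    |b - a| (fun g => by
      rw [mul_comm]
      exact intervalIntegral.norm_integral_le_of_norm_le_const
        fun θ _ => g.norm_coe_le_norm (projIcc a b hab θ))

theorem integralIccCLM_apply {a b : ℝ} (hab : a ≤ b) (g : C(Icc a b, ℝ)) (f : ℝ → ℝ)
    (h : ∀ θ : Icc a b, g θ = f θ) : integralIccCLM hab g = ∫ θ in a..b, f θ := by
  change ∫ θ in a..b, IccExtend hab g θ = _
  refine intervalIntegral.integral_congr fun θ hθ => ?_
  rw [uIcc_of_le hab] at hθ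
  simp only [IccExtend_of_mem hab _ hθ]
  exact h ⟨θ, hθ⟩

/-- A power series with real coefficients, evaluated in the Banach algebra `C(K, ℝ)`, acts
pointwise. -/
theorem HasFPowerSeriesOnBall.analyticAt_comp_continuousMap {K : Type*} [TopologicalSpace K]
    [CompactSpace K] [Nonempty K] {f : ℝ → ℝ} {p : FormalMultilinearSeries ℝ ℝ ℝ} {c : ℝ}
    {ε : NNReal} (hf : HasFPowerSeriesOnBall f p c ε) :
    ∃ Φ : C(K, ℝ) → C(K, ℝ), ∀ u : C(K, ℝ), ‖u‖ < ε →
      AnalyticAt ℝ Φ u ∧ ∀ x, Φ u x = f (c + u x) := by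
  -- The same scalar coefficients have the same norms in the algebra `C(K, ℝ)`, so no radius of
  -- convergence is lost.
  set P := FormalMultilinearSeries.ofScalars C(K, ℝ) (𝕜 := ℝ) p.coeff with hP
  have hrad : p.radius ≤ P.radius := by
    refine FormalMultilinearSeries.radius_le_of_le fun {n} => ?_
    rw [hP, FormalMultilinearSeries.ofScalars_norm, FormalMultilinearSeries.norm_apply_eq_norm_coef]
  have hε : (ε : ENNReal) ≤ P.radius := hf.r_le.trans hrad
  have hPs : HasFPowerSeriesOnBall P.sum P 0 P.radius :=
    P.hasFPowerSeriesOnBall (hf.r_pos.trans_le hε)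
  refine ⟨P.sum, fun u hu => ?_⟩
  have hmem : u ∈ Metric.eball (0 : C(K, ℝ)) P.radius := by
    refine Metric.eball_subset_eball hε ?_
    rw [Metric.eball_coe]
    simpa using hu
  refine ⟨hPs.analyticAt_of_mem hmem, fun x => ?_⟩
  have h1 := hPs.hasSum hmem
  rw [zero_add] at h1
  have h2 : HasSum (fun n => (P n fun _ => u) x) (P.sum u x) :=
    h1.map ((ContinuousMap.evalCLM ℝ x : C(K, ℝ) →L[ℝ] ℝ)) (ContinuousLinearMap.continuous _)
  have hmem' : u x ∈ Metric.eball (0 : ℝ) ε := by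
    rw [Metric.eball_coe]
    simpa using (u.norm_coe_le_norm x).trans_lt hu
  have h3 := hf.hasSum hmem'
  refine h2.unique (h3.congr_fun ?_)
  intro n
  rw [hP, FormalMultilinearSeries.ofScalars_apply_eq,
    FormalMultilinearSeries.apply_eq_pow_smul_coeff]
  simp [mul_comm]

/-- The function is a composition of three analytic maps: the affine map `r ↦ r • s - c` into `C([a,
b], ℝ)`, the power series of `f` acting there, and integration. `hnear` puts the curve inside the
ball of convergence in sup norm. -/
theorem analyticAt_integral_comp_mul_of_ball {f s : ℝ → ℝ} {a b r₀ c : ℝ} (hab : a ≤ b)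
    {p : FormalMultilinearSeries ℝ ℝ ℝ} {ε : NNReal} (hf : HasFPowerSeriesOnBall f p c ε)
    (hs : Continuous s) (hnear : ∀ θ ∈ Icc a b, |r₀ * s θ - c| < ε) :
    AnalyticAt ℝ (fun r => ∫ θ in a..b, f (r * s θ)) r₀ := by
  have : Nonempty (Icc a b) := ⟨⟨a, left_mem_Icc.2 hab⟩⟩
  obtain ⟨Φ, hΦ⟩ := hf.analyticAt_comp_continuousMap (K := Icc a b)
  let S : C(Icc a b, ℝ) := ⟨fun θ => s θ, by fun_prop⟩
  let C : C(Icc a b, ℝ) := ContinuousMap.const _ c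
  let u : ℝ → C(Icc a b, ℝ) := fun r => r • S - C
  have hε : (0 : ℝ) < ε := by exact_mod_cast hf.r_pos
  have hu : AnalyticAt ℝ u r₀ := by fun_prop
  have hur : ‖u r₀‖ < ε := by
    rw [ContinuousMap.norm_lt_iff _ hε]
    intro θ
    simpa [u, S, C] using hnear θ θ.2
  have hev : ∀ᶠ r in 𝓝 r₀, ‖u r‖ < ε :=
    hu.continuousAt.norm.eventually (gt_mem_nhds hur)
  have h1 : AnalyticAt ℝ (fun r => integralIccCLM hab (Φ (u r))) r₀ :=
    ((integralIccCLM hab).analyticAt _).comp (AnalyticAt.comp (hΦ _ hur).1 hu)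
  refine h1.congr ?_
  filter_upwards [hev] with r hr
  refine integralIccCLM_apply hab _ _ fun θ => ?_
  rw [(hΦ _ hr).2 θ]
  simp [u, S, C]

/-- If `f` is real analytic and `s` is continuous then `r ↦ ∫ f (r s(θ)) dθ` is real analytic. -/
theorem analyticAt_integral_comp_mul {f s : ℝ → ℝ} (hf : ∀ x, AnalyticAt ℝ f x)
    (hs : Continuous s) {a b : ℝ} (hab : a ≤ b) (r₀ : ℝ) :
    AnalyticAt ℝ (fun r => ∫ θ in a..b, f (r * s θ)) r₀ := by
  have hball : ∀ c : ℝ, ∃ ε : NNReal, ∃ p : FormalMultilinearSeries ℝ ℝ ℝ,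
      HasFPowerSeriesOnBall f p c ε := by
    intro c
    obtain ⟨p, r, hp⟩ := hf c
    obtain ⟨ε, hε, hεr⟩ := ENNReal.lt_iff_exists_nnreal_btwn.1 hp.r_pos
    exact ⟨ε, p, hp.mono hε hεr.le⟩
  choose ε p hp using hball
  have hfc : Continuous f := continuous_iff_continuousAt.2 fun x => (hf x).continuousAt
  -- One power series need not cover the range of `r₀ * s`; compactness gives a finite subdivision
  -- on each piece of which a single series suffices.
  let U : ℝ → Set (Icc a b) := fun c => {θ | |r₀ * s θ - c| < ε c}
  have hU : ∀ c, IsOpen (U c) := fun c =>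
    isOpen_lt (by fun_prop) continuous_const
  have hcov : univ ⊆ ⋃ c, U c := fun θ _ => mem_iUnion.2 ⟨r₀ * s θ, by
    have : (0 : ℝ) < ε (r₀ * s θ) := by exact_mod_cast (hp (r₀ * s θ)).r_pos
    simpa [U] using this⟩
  obtain ⟨t, ht0, htm, ⟨m, hm⟩, ht⟩ := exists_monotone_Icc_subset_open_cover_Icc hab hU hcov
  have hsum : ∀ r, ∫ θ in a..b, f (r * s θ) =
      ∑ k ∈ Finset.range m, ∫ θ in (t k : ℝ)..t (k + 1), f (r * s θ) := by
    intro r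
    rw [intervalIntegral.sum_integral_adjacent_intervals (a := fun k => (t k : ℝ))
      (fun k _ => (by fun_prop : Continuous fun θ => f (r * s θ)).intervalIntegrable _ _)]
    simp only [ht0, hm m le_rfl]
  simp only [hsum]
  refine Finset.analyticAt_fun_sum _ fun k _ => ?_
  obtain ⟨c, hc⟩ := ht k
  refine analyticAt_integral_comp_mul_of_ball (htm (Nat.le_succ k)) (hp c) hs fun θ hθ => ?_
  have hθ' : θ ∈ Icc a b := ⟨(t k).2.1.trans hθ.1, hθ.2.trans (t (k + 1)).2.2⟩
  exact hc (show (⟨θ, hθ'⟩ : Icc a b) ∈ Icc (t k) (t (k + 1)) from hθ)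

/-! ### Analytic square roots and inverses -/

theorem AnalyticAt.dslope {f : ℝ → ℝ} {a x : ℝ} (ha : AnalyticAt ℝ f a) (hx : AnalyticAt ℝ f x) :
    AnalyticAt ℝ (dslope f a) x := by
  rcases eq_or_ne x a with rfl | h
  · obtain ⟨p, hp⟩ := ha
    exact hp.has_fpower_series_dslope_fslope.analyticAt
  · have : AnalyticAt ℝ (fun y => (y - a)⁻¹ * (f y - f a)) x := by
      refine ((analyticAt_id.sub analyticAt_const).inv ?_).mul (hx.sub analyticAt_const)
      simpa [sub_eq_zero] using h
    refine this.congr ?_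
    filter_upwards [dslope_eventuallyEq_slope_of_ne f h] with y hy
    rw [hy, slope_def_field]
    ring

/-- An analytic function with a non-degenerate minimum of value `0` at the origin, and no other
critical point, is the square of an analytic function with positive derivative. -/
theorem exists_analytic_sqrt {W W' : ℝ → ℝ} {k : ℝ} (hW : ∀ y, AnalyticAt ℝ W y)
    (hW' : ∀ y, HasDerivAt W (W' y) y) (h0 : W 0 = 0) (hpos : ∀ y, y ≠ 0 → 0 < y * W' y)
    (hWpos : ∀ y, y ≠ 0 → 0 < W y)
    (hk : HasDerivAt W' k 0) (hk0 : 0 < k) :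
    ∃ H : ℝ → ℝ, (∀ y, AnalyticAt ℝ H y) ∧ (∀ y, H y ^ 2 = W y) ∧ (∀ y, 0 < deriv H y) ∧
      2 * deriv H 0 ^ 2 = k ∧ H 0 = 0 := by
  have hW'0 : W' 0 = 0 := by
    have hmin : IsLocalMin W 0 := Filter.Eventually.of_forall fun y => by
      rcases eq_or_ne y 0 with rfl | hy
      · exact le_rfl
      · exact h0.symm ▸ (hWpos y hy).le
    exact hmin.hasDerivAt_eq_zero (hW' 0)
  set Q := dslope W 0 with hQ
  have hQa : ∀ y, AnalyticAt ℝ Q y := fun y => (hW 0).dslope (hW y)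
  -- Dividing twice by `y` gives `W = y² K` with `K` analytic and positive; the square root sought
  -- is `y √K`.
  set K := dslope Q 0 with hK
  have hKa : ∀ y, AnalyticAt ℝ K y := fun y => (hQa 0).dslope (hQa y)
  have hQ0 : Q 0 = 0 := by rw [hQ, dslope_same, (hW' 0).deriv, hW'0]
  have hWQ : ∀ y, W y = y * Q y := fun y => by
    have := sub_smul_dslope W 0 y
    simp only [h0, sub_zero, smul_eq_mul] at this
    exact this.symm
  have hQK : ∀ y, Q y = y * K y := fun y => by
    have := sub_smul_dslope Q 0 y
    simp only [hQ0, sub_zero, smul_eq_mul] at this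
    exact this.symm
  have hWK : ∀ y, W y = y ^ 2 * K y := fun y => by rw [hWQ, hQK]; ring
  have hKd : ∀ y, HasDerivAt K (deriv K y) y := fun y => (hKa y).differentiableAt.hasDerivAt
  have hW'K : ∀ y, W' y = y * (2 * K y + y * deriv K y) := fun y => by
    have h1 : HasDerivAt W (2 * y * K y + y ^ 2 * deriv K y) y := by
      rw [show W = fun y => y ^ 2 * K y from funext hWK]
      simpa using (hasDerivAt_pow 2 y).fun_mul (hKd y)
    rw [(hW' y).unique h1]; ring
  have hK0 : 2 * K 0 = k := by
    have hd : DifferentiableAt ℝ (fun y => 2 * K y + y * deriv K y) 0 :=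
      ((hKa 0).differentiableAt.const_mul 2).add
        (differentiableAt_id.mul (hKa 0).deriv.differentiableAt)
    have hk' : HasDerivAt (fun y => y * (2 * K y + y * deriv K y)) k 0 := by
      rwa [show W' = fun y => y * (2 * K y + y * deriv K y) from funext hW'K] at hk
    have := ((hasDerivAt_id' (0 : ℝ)).fun_mul hd.hasDerivAt).unique hk'
    simpa using this
  have hKpos : ∀ y, 0 < K y := fun y => by
    rcases eq_or_ne y 0 with rfl | hy
    · linarith
    · have := hWpos y hy
      rw [hWK] at this
      exact pos_of_mul_pos_right this (sq_nonneg y)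
  have hsa : ∀ y, AnalyticAt ℝ (fun y => √(K y)) y := fun y => by
    have h1 : AnalyticAt ℝ Real.sqrt (K y) := by
      -- The exponent `⊤` is the analytic class `ω`, above `C^∞`.
      have := (Real.contDiffAt_sqrt (n := ⊤) (hKpos y).ne')
      exact this.analyticAt
    exact h1.comp (hKa y)
  have hHa : ∀ y, AnalyticAt ℝ (fun y => y * √(K y)) y := fun y => analyticAt_id.mul (hsa y)
  have hsq : ∀ y, (y * √(K y)) ^ 2 = W y := fun y => by
    rw [mul_pow, Real.sq_sqrt (hKpos y).le, hWK]
  have hd0 : deriv (fun y => y * √(K y)) 0 = √(K 0) := by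
    have := ((hasDerivAt_id' (0 : ℝ)).fun_mul (hsa 0).differentiableAt.hasDerivAt).deriv
    simpa using this
  refine ⟨fun y => y * √(K y), hHa, hsq, fun y => ?_, ?_, by simp⟩
  · rcases eq_or_ne y 0 with rfl | hy
    · rw [hd0]
      exact Real.sqrt_pos.2 (hKpos 0)
    · have h1 : HasDerivAt W (2 * (y * √(K y)) * deriv (fun y => y * √(K y)) y) y := by
        rw [show W = fun y => (y * √(K y)) ^ 2 from funext fun y => (hsq y).symm]
        simpa using (hHa y).differentiableAt.hasDerivAt.fun_pow 2
      have h2 := hpos y hy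
      rw [(hW' y).unique h1] at h2
      have h3 : 0 < (2 * y ^ 2 * √(K y)) * deriv (fun y => y * √(K y)) y := by
        calc _ < _ := h2
          _ = _ := by ring
      exact pos_of_mul_pos_right h3 (by positivity)
  · rw [hd0, Real.sq_sqrt (hKpos 0).le, hK0]

/-- The inverse of an analytic bijection of the line with positive derivative is analytic. -/
theorem exists_analytic_inverse {H : ℝ → ℝ} (hH : ∀ y, AnalyticAt ℝ H y)
    (hpos : ∀ y, 0 < deriv H y) (htop : Tendsto H atTop atTop) (hbot : Tendsto H atBot atBot) :
    ∃ e : ℝ ≃o ℝ, (∀ y, e y = H y) ∧ (∀ h, AnalyticAt ℝ e.symm h) ∧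
      ∀ h, HasDerivAt e.symm (deriv H (e.symm h))⁻¹ h := by
  have hcont : Continuous H := continuous_iff_continuousAt.2 fun x => (hH x).continuousAt
  have hmono : StrictMono H := strictMono_of_deriv_pos hpos
  let e : ℝ ≃o ℝ := hmono.orderIsoOfSurjective H (hcont.surjective htop hbot)
  have he : ∀ y, e y = H y := fun y => rfl
  refine ⟨e, he, fun h => ?_, fun h => ?_⟩
  · have hc : ContDiff ℝ ⊤ H := contDiff_iff_contDiffAt.2 fun y => (hH y).contDiffAt
    have h1 : ContDiff ℝ ⊤ e.toHomeomorph.symm := e.toHomeomorph.contDiff_symm_deriv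
      (fun y => (hpos y).ne') (fun y => (hH y).differentiableAt.hasDerivAt) hc
    exact h1.contDiffAt.analyticAt
  · refine HasDerivAt.of_local_left_inverse (f := H) e.symm.continuous.continuousAt
      (hH _).differentiableAt.hasDerivAt (hpos _).ne' (Eventually.of_forall fun y => ?_)
    exact e.apply_symm_apply y

/-! ### The period as an angular integral -/

section Parametrization

variable {V X X' : ℝ → ℝ} {D : Set ℝ}

theorem turningPoints_eq_of_parametrization (hVX : ∀ h, V (X h) = h ^ 2) (hXD : ∀ h, X h ∈ D)
    (hsurj : ∀ x ∈ D, ∃ h, X h = x) {r : ℝ} :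
    turningPoints V D (r ^ 2) = {X (-r), X r} := by
  ext x
  simp only [turningPoints, mem_ofPred_eq, mem_insert_iff, mem_singleton_iff]
  constructor
  · rintro ⟨hx, hV⟩
    obtain ⟨h, rfl⟩ := hsurj x hx
    rw [hVX] at hV
    rcases sq_eq_sq_iff_eq_or_eq_neg.1 hV with rfl | rfl
    · exact Or.inr rfl
    · exact Or.inl rfl
  · rintro (rfl | rfl)
    · exact ⟨hXD _, by rw [hVX, neg_sq]⟩
    · exact ⟨hXD _, hVX _⟩

theorem leftTurningPoint_eq_of_parametrization (hVX : ∀ h, V (X h) = h ^ 2) (hXD : ∀ h, X h ∈ D)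
    (hsurj : ∀ x ∈ D, ∃ h, X h = x) (hmono : StrictMono X) {r : ℝ} (hr : 0 < r) :
    leftTurningPoint V D (r ^ 2) = X (-r) := by
  rw [leftTurningPoint, turningPoints_eq_of_parametrization hVX hXD hsurj, csInf_pair]
  exact inf_eq_left.2 (hmono.monotone (by linarith))

theorem rightTurningPoint_eq_of_parametrization (hVX : ∀ h, V (X h) = h ^ 2) (hXD : ∀ h, X h ∈ D)
    (hsurj : ∀ x ∈ D, ∃ h, X h = x) (hmono : StrictMono X) {r : ℝ} (hr : 0 < r) :
    rightTurningPoint V D (r ^ 2) = X r := by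
  rw [rightTurningPoint, turningPoints_eq_of_parametrization hVX hXD hsurj, csSup_pair]
  exact sup_eq_right.2 (hmono.monotone (by linarith))

theorem image_comp_mul_sin (hcont : Continuous X) (hmono : StrictMono X) {r : ℝ} (hr : 0 < r) :
    (fun θ => X (r * Real.sin θ)) '' Ioo (-(Real.pi / 2)) (Real.pi / 2) =
      Ioo (X (-r)) (X r) := by
  ext x
  constructor
  · rintro ⟨θ, hθ, rfl⟩
    have h1 : Real.sin θ < 1 := by
      simpa using Real.strictMonoOn_sin (Ioo_subset_Icc_self hθ)
        (right_mem_Icc.2 (by linarith [Real.pi_pos])) hθ.2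
    have h2 : -1 < Real.sin θ := by
      simpa using Real.strictMonoOn_sin (left_mem_Icc.2 (by linarith [Real.pi_pos]))
        (Ioo_subset_Icc_self hθ) hθ.1
    exact ⟨hmono (by nlinarith), hmono (by nlinarith)⟩
  · intro hx
    obtain ⟨h, -, rfl⟩ := intermediate_value_Icc (by linarith : -r ≤ r) hcont.continuousOn
      (Ioo_subset_Icc_self hx)
    have h1 : h / r < 1 := (div_lt_one hr).2 (hmono.lt_iff_lt.1 hx.2)
    have h2 : -1 < h / r := (lt_div_iff₀ hr).2 (by linarith [hmono.lt_iff_lt.1 hx.1])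
    refine ⟨Real.arcsin (h / r), ⟨Real.neg_pi_div_two_lt_arcsin.2 h2,
      Real.arcsin_lt_pi_div_two.2 h1⟩, ?_⟩
    simp only [Real.sin_arcsin h2.le h1.le]
    congr 1
    field_simp

/-- The substitution `x = X (r sin θ)` in the period integral. -/
theorem integral_period_of_parametrization (hVX : ∀ h, V (X h) = h ^ 2)
    (hX : ∀ h, HasDerivAt X (X' h) h) (hX' : Continuous X') (hpos : ∀ h, 0 < X' h)
    {r : ℝ} (hr : 0 < r) :
    IntervalIntegrable (fun x => 1 / √(2 * (r ^ 2 - V x))) volume (X (-r)) (X r) ∧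
      ∫ x in X (-r)..X r, 1 / √(2 * (r ^ 2 - V x)) =
        (√2)⁻¹ * ∫ θ in -(Real.pi / 2)..Real.pi / 2, X' (r * Real.sin θ) := by
  have hmono : StrictMono X :=
    strictMono_of_deriv_pos fun h => by rw [(hX h).deriv]; exact hpos h
  have hcont : Continuous X := continuous_iff_continuousAt.2 fun h => (hX h).continuousAt
  have hle : X (-r) ≤ X r := hmono.monotone (by linarith)
  have hpi : -(Real.pi / 2) ≤ Real.pi / 2 := by linarith [Real.pi_pos]
  set S := Ioo (-(Real.pi / 2)) (Real.pi / 2) with hS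
  have hderiv : ∀ θ ∈ S, HasDerivWithinAt (fun θ => X (r * Real.sin θ))
      (X' (r * Real.sin θ) * (r * Real.cos θ)) S θ := fun θ _ =>
    ((hX _).comp θ ((Real.hasDerivAt_sin θ).const_mul r)).hasDerivWithinAt
  have hinj : InjOn (fun θ => X (r * Real.sin θ)) S := fun θ hθ θ' hθ' h =>
    Real.injOn_sin (Ioo_subset_Icc_self hθ) (Ioo_subset_Icc_self hθ')
      (mul_left_cancel₀ hr.ne' (hmono.injective h))
  -- The Jacobian factor `r cos θ` cancels `√(r² - r² sin² θ)`, which removes the endpoint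
  -- singularities.
  have hintegrand : ∀ θ ∈ S, |X' (r * Real.sin θ) * (r * Real.cos θ)| •
      (1 / √(2 * (r ^ 2 - V (X (r * Real.sin θ))))) = (√2)⁻¹ * X' (r * Real.sin θ) := by
    intro θ hθ
    have hc : 0 < Real.cos θ := Real.cos_pos_of_mem_Ioo hθ
    have h1 : 2 * (r ^ 2 - V (X (r * Real.sin θ))) = 2 * (r * Real.cos θ) ^ 2 := by
      rw [hVX, mul_pow, mul_pow, Real.cos_sq']; ring
    rw [h1, Real.sqrt_mul (by norm_num), Real.sqrt_sq (by positivity),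
      abs_of_pos (mul_pos (hpos _) (by positivity)), smul_eq_mul]
    field_simp
  have hint : IntegrableOn (fun θ => (√2)⁻¹ * X' (r * Real.sin θ)) S :=
    ((by fun_prop : Continuous fun θ => (√2)⁻¹ * X' (r * Real.sin θ)).integrableOn_Icc).mono_set
      Ioo_subset_Icc_self
  constructor
  · rw [intervalIntegrable_iff_integrableOn_Ioo_of_le hle, ← image_comp_mul_sin hcont hmono hr,
      integrableOn_image_iff_integrableOn_abs_deriv_smul measurableSet_Ioo hderiv hinj]
    exact (integrableOn_congr_fun hintegrand measurableSet_Ioo).2 hint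
  · rw [intervalIntegral.integral_of_le hle, integral_Ioc_eq_integral_Ioo,
      ← image_comp_mul_sin hcont hmono hr,
      integral_image_eq_integral_abs_deriv_smul measurableSet_Ioo hderiv hinj,
      setIntegral_congr_fun measurableSet_Ioo hintegrand, ← integral_Ioc_eq_integral_Ioo,
      ← intervalIntegral.integral_of_le hpi, intervalIntegral.integral_const_mul]

theorem period_eq_of_parametrization (hVX : ∀ h, V (X h) = h ^ 2) (hXD : ∀ h, X h ∈ D)
    (hsurj : ∀ x ∈ D, ∃ h, X h = x) (hX : ∀ h, HasDerivAt X (X' h) h) (hX' : Continuous X')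
    (hpos : ∀ h, 0 < X' h) {r : ℝ} (hr : 0 < r) :
    period V D (r ^ 2) =
      √2 * ∫ θ in -(Real.pi / 2)..Real.pi / 2, X' (r * Real.sin θ) := by
  have hmono : StrictMono X :=
    strictMono_of_deriv_pos fun h => by rw [(hX h).deriv]; exact hpos h
  rw [period, leftTurningPoint_eq_of_parametrization hVX hXD hsurj hmono hr,
    rightTurningPoint_eq_of_parametrization hVX hXD hsurj hmono hr,
    (integral_period_of_parametrization hVX hX hX' hpos hr).2, ← mul_assoc]
  congr 1
  rw [← div_eq_mul_inv, Real.div_sqrt]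

end Parametrization

/-! ### The high-energy limit of the angular integral -/

theorem exists_bound_of_tendsto_atTop_atBot {f : ℝ → ℝ} {A B : ℝ} (hf : Continuous f)
    (htop : Tendsto f atTop (𝓝 A)) (hbot : Tendsto f atBot (𝓝 B)) : ∃ C, ∀ x, ‖f x‖ ≤ C := by
  obtain ⟨M, hM⟩ := eventually_atTop.1 (htop.norm.eventually (ge_mem_nhds (lt_add_one ‖A‖)))
  obtain ⟨N, hN⟩ := eventually_atBot.1 (hbot.norm.eventually (ge_mem_nhds (lt_add_one ‖B‖)))
  obtain ⟨C, hC⟩ := isCompact_Icc.exists_bound_of_continuousOn (hf.continuousOn (s := Icc N M))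
  refine ⟨max C (max (‖A‖ + 1) (‖B‖ + 1)), fun x => ?_⟩
  rcases le_total M x with h | h
  · exact (hM x h).trans (by simp)
  · rcases le_total x N with h' | h'
    · exact (hN x h').trans (by simp)
    · exact (hC x ⟨h', h⟩).trans (by simp)

/-- The sign of `sin θ` decides which limit `f (r sin θ)` has, so each half of the interval
contributes its own limit by dominated convergence. -/
theorem tendsto_integral_comp_mul_sin {f : ℝ → ℝ} {A B : ℝ} (hf : Continuous f)
    (htop : Tendsto f atTop (𝓝 A)) (hbot : Tendsto f atBot (𝓝 B)) :
    Tendsto (fun r : ℝ => ∫ θ in -(Real.pi / 2)..Real.pi / 2, f (r * Real.sin θ)) atTop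
      (𝓝 (Real.pi / 2 * (A + B))) := by
  obtain ⟨C, hC⟩ := exists_bound_of_tendsto_atTop_atBot hf htop hbot
  have hpi := Real.pi_pos
  have hright : Tendsto (fun r : ℝ => ∫ θ in 0..Real.pi / 2, f (r * Real.sin θ)) atTop
      (𝓝 (∫ _ in 0..Real.pi / 2, A)) := by
    refine intervalIntegral.tendsto_integral_filter_of_dominated_convergence (fun _ => C)
      (Eventually.of_forall fun r => (by fun_prop : Continuous _).aestronglyMeasurable)
      (Eventually.of_forall fun r => Eventually.of_forall fun θ _ => hC _)
      (by simp) (Eventually.of_forall fun θ hθ => ?_)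
    rw [uIoc_of_le (by positivity)] at hθ
    exact htop.comp (tendsto_id.atTop_mul_const
      (Real.sin_pos_of_pos_of_lt_pi hθ.1 (by linarith [hθ.2])))
  have hleft : Tendsto (fun r : ℝ => ∫ θ in -(Real.pi / 2)..0, f (r * Real.sin θ)) atTop
      (𝓝 (∫ _ in -(Real.pi / 2)..0, B)) := by
    refine intervalIntegral.tendsto_integral_filter_of_dominated_convergence (fun _ => C)
      (Eventually.of_forall fun r => (by fun_prop : Continuous _).aestronglyMeasurable)
      (Eventually.of_forall fun r => Eventually.of_forall fun θ _ => hC _)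
      (by simp) ?_
    -- Unlike the right half, this half-open interval contains `θ = 0`, where the sine vanishes; it
    -- is discarded as a null set.
    filter_upwards [compl_mem_ae_iff.2 (measure_singleton (0 : ℝ))] with θ hθ0 hθ
    rw [uIoc_of_le (by linarith)] at hθ
    exact hbot.comp (tendsto_id.atTop_mul_const_of_neg
      (Real.sin_neg_of_neg_of_neg_pi_lt (lt_of_le_of_ne hθ.2 hθ0) (by linarith [hθ.1])))
  have hsum := hleft.add hright
  simp only [intervalIntegral.integral_const, smul_eq_mul] at hsum
  refine (hsum.congr fun r => ?_).trans (le_of_eq ?_)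
  · exact intervalIntegral.integral_add_adjacent_intervals
      ((by fun_prop : Continuous _).intervalIntegrable _ _)
      ((by fun_prop : Continuous _).intervalIntegrable _ _)
  · congr 1; ring

/-! ### The potential in the logarithmic coordinate -/

/-- The repulsive part of the potential with `a = d - 2`, in the coordinate `y = ln x`. -/
noncomputable def logRepulsion (a y : ℝ) : ℝ :=
  if a = 0 then -y else (Real.exp (-(a * y)) - 1) / a

/-- The potential with `a = d - 2`, in the coordinate `y = ln x`. -/
noncomputable def logPotential (a y : ℝ) : ℝ := logRepulsion a y + (Real.exp (2 * y) - 1) / 2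

theorem potential_exp (d : ℕ) (y : ℝ) :
    potential d (Real.exp y) = logPotential ((d : ℝ) - 2) y := by
  have hd : (d : ℝ) - 2 = 0 ↔ d = 2 := by
    rw [sub_eq_zero]; norm_cast
  have h2 : Real.exp y ^ 2 = Real.exp (2 * y) := by rw [← Real.exp_nat_mul]; norm_num
  have hz : Real.exp y ^ (2 - (d : ℤ)) = Real.exp (-(((d : ℝ) - 2) * y)) := by
    rw [← Real.rpow_intCast, ← Real.exp_mul]; congr 1; push_cast; ring
  simp only [potential, logPotential, logRepulsion, hd, Real.log_exp, h2, hz]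

section LogPotential

variable {a : ℝ}

theorem hasDerivAt_logRepulsion (a y : ℝ) :
    HasDerivAt (logRepulsion a) (-Real.exp (-(a * y))) y := by
  by_cases ha : a = 0
  · have : logRepulsion a = fun y => -y := by ext y; simp [logRepulsion, ha]
    rw [this]
    simpa [ha] using (hasDerivAt_id' y).fun_neg
  · have : logRepulsion a = fun y => (Real.exp (-(a * y)) - 1) / a := by
      ext y; simp [logRepulsion, ha]
    rw [this]
    have h := ((((hasDerivAt_id' y).const_mul a).fun_neg.exp).sub_const 1).div_const a
    refine h.congr_deriv ?_
    field_simp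

theorem analyticAt_logPotential (a y : ℝ) : AnalyticAt ℝ (logPotential a) y := by
  by_cases ha : a = 0
  · have : logPotential a = fun y => -y + (Real.exp (2 * y) - 1) / 2 := by
      ext y; simp [logPotential, logRepulsion, ha]
    rw [this]
    fun_prop (disch := norm_num)
  · have : logPotential a = fun y => (Real.exp (-(a * y)) - 1) / a + (Real.exp (2 * y) - 1) / 2 := by
      ext y; simp [logPotential, logRepulsion, ha]
    rw [this]
    fun_prop (disch := first | exact ha | norm_num)

theorem hasDerivAt_logPotential (a y : ℝ) :
    HasDerivAt (logPotential a) (Real.exp (2 * y) - Real.exp (-(a * y))) y := by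
  have h := (hasDerivAt_logRepulsion a y).fun_add
    (((((hasDerivAt_id' y).const_mul 2).exp).sub_const 1).div_const 2)
  refine h.congr_deriv ?_
  ring

theorem neg_le_logRepulsion (ha : 0 ≤ a) (y : ℝ) : -y ≤ logRepulsion a y := by
  rcases ha.eq_or_lt with rfl | ha
  · simp [logRepulsion]
  · rw [logRepulsion, if_neg ha.ne', le_div_iff₀ ha]
    linarith [Real.add_one_le_exp (-(a * y))]

theorem logRepulsion_nonpos (ha : 0 ≤ a) {y : ℝ} (hy : 0 ≤ y) : logRepulsion a y ≤ 0 := by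
  rcases ha.eq_or_lt with rfl | ha
  · simpa [logRepulsion] using hy
  · rw [logRepulsion, if_neg ha.ne']
    refine div_nonpos_of_nonpos_of_nonneg ?_ ha.le
    have : Real.exp (-(a * y)) ≤ 1 := Real.exp_le_one_iff.2 (by nlinarith)
    linarith

/-- Multiply `1 + a y ≤ exp (a y)` by `exp (-(a y))`. This form of the bound also covers `a = 0`. -/
theorem logRepulsion_le (ha : 0 ≤ a) (y : ℝ) : logRepulsion a y ≤ -y * Real.exp (-(a * y)) := by
  rcases ha.eq_or_lt with rfl | ha
  · simp [logRepulsion]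
  · rw [logRepulsion, if_neg ha.ne', div_le_iff₀ ha]
    have h1 := Real.add_one_le_exp (a * y)
    have h2 : Real.exp (a * y) * Real.exp (-(a * y)) = 1 := by rw [← Real.exp_add]; simp
    nlinarith [Real.exp_pos (-(a * y))]

/-- The lower bound is the potential for `a = 0`; it yields positivity and growth for all `a ≥ 0` at
once. -/
theorem logPotential_lower (ha : 0 ≤ a) (y : ℝ) :
    -y + (Real.exp (2 * y) - 1) / 2 ≤ logPotential a y :=
  add_le_add_left (neg_le_logRepulsion ha y) _

theorem logPotential_pos (ha : 0 ≤ a) {y : ℝ} (hy : y ≠ 0) : 0 < logPotential a y := by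
  have h := Real.add_one_lt_exp (mul_ne_zero two_ne_zero hy)
  linarith [logPotential_lower ha y]

theorem mul_deriv_logPotential_pos (ha : 0 ≤ a) {y : ℝ} (hy : y ≠ 0) :
    0 < y * (Real.exp (2 * y) - Real.exp (-(a * y))) := by
  rcases hy.lt_or_gt with h | h
  · exact mul_pos_of_neg_of_neg h (sub_neg.2 (Real.exp_lt_exp.2 (by nlinarith)))
  · exact mul_pos h (sub_pos.2 (Real.exp_lt_exp.2 (by nlinarith)))

theorem tendsto_logPotential_atTop (ha : 0 ≤ a) : Tendsto (logPotential a) atTop atTop := by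
  refine tendsto_atTop_mono' _ ?_ (tendsto_pow_atTop (two_ne_zero (α := ℕ)) : 
    Tendsto (fun y : ℝ => y ^ 2) atTop atTop)
  filter_upwards [eventually_ge_atTop 0] with y hy
  -- From `exp (2y) ≥ 1 + 2y + 2y²` the potential is at least `y²`.
  have h := Real.quadratic_le_exp_of_nonneg (by positivity : 0 ≤ 2 * y)
  nlinarith [logPotential_lower ha y]

theorem tendsto_logPotential_atBot (ha : 0 ≤ a) : Tendsto (logPotential a) atBot atTop := by
  refine tendsto_atTop_mono (fun y => ?_)
    (tendsto_atTop_add_const_right _ (-1 / 2 : ℝ) tendsto_neg_atBot_atTop)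
  linarith [logPotential_lower ha y, Real.exp_pos (2 * y)]

theorem tendsto_mul_exp_neg_mul_atTop {c : ℝ} (hc : 0 < c) :
    Tendsto (fun y : ℝ => y * Real.exp (-(c * y))) atTop (𝓝 0) := by
  have h := (Real.tendsto_pow_mul_exp_neg_atTop_nhds_zero 1).comp
    (tendsto_id.const_mul_atTop hc : Tendsto (fun y : ℝ => c * y) atTop atTop)
  have h' := h.const_mul c⁻¹
  rw [mul_zero] at h'
  refine h'.congr fun y => ?_
  simp only [Function.comp_apply, pow_one]
  field_simp

theorem tendsto_exp_neg_mul_atTop {c : ℝ} (hc : 0 < c) :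
    Tendsto (fun y : ℝ => Real.exp (-(c * y))) atTop (𝓝 0) :=
  Real.tendsto_exp_neg_atTop_nhds_zero.comp (tendsto_id.const_mul_atTop hc)

theorem tendsto_logPotential_mul_exp (ha : 0 ≤ a) :
    Tendsto (fun y => logPotential a y * Real.exp (-(2 * y))) atTop (𝓝 (1 / 2)) := by
  have he := tendsto_exp_neg_mul_atTop (c := 2) two_pos
  have hm := tendsto_mul_exp_neg_mul_atTop (c := 2) two_pos
  have hup : Tendsto (fun y : ℝ => 1 / 2 - Real.exp (-(2 * y)) / 2) atTop (𝓝 (1 / 2)) := by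
    simpa only [zero_div, sub_zero] using (he.div_const 2).const_sub (1 / 2)
  have hlow : Tendsto (fun y : ℝ => (1 / 2 - Real.exp (-(2 * y)) / 2) -
      y * Real.exp (-(2 * y))) atTop (𝓝 (1 / 2)) := by
    simpa using hup.sub hm
  have hexp : ∀ y : ℝ, Real.exp (2 * y) * Real.exp (-(2 * y)) = 1 := fun y => by
    rw [← Real.exp_add]; simp
  refine tendsto_of_tendsto_of_tendsto_of_le_of_le' hlow hup
    (Eventually.of_forall fun y => ?_) ?_
  · nlinarith [logPotential_lower ha y, hexp y, Real.exp_pos (-(2 * y))]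
  · filter_upwards [eventually_ge_atTop 0] with y hy
    have : logPotential a y ≤ (Real.exp (2 * y) - 1) / 2 := by
      rw [logPotential]; linarith [logRepulsion_nonpos ha hy]
    nlinarith [hexp y, Real.exp_pos (-(2 * y))]

/-- The quotient is `dx/dh = 2 h e^y / W'(y)` with `h = √W`. Here `W ~ e^(2y)/2` and `W' ~ e^(2y)`.
-/
theorem tendsto_velocity_atTop (ha : 0 ≤ a) :
    Tendsto (fun y => Real.exp y * (2 * √(logPotential a y)) /
      (Real.exp (2 * y) - Real.exp (-(a * y)))) atTop (𝓝 √2) := by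
  have h1 := ((tendsto_logPotential_mul_exp ha).sqrt).const_mul 2
  have h2 : Tendsto (fun y : ℝ => 1 - Real.exp (-((a + 2) * y))) atTop (𝓝 1) := by
    simpa using (tendsto_exp_neg_mul_atTop (c := a + 2) (by linarith)).const_sub 1
  have h3 := h1.div h2 one_ne_zero
  have hlim : 2 * √(1 / 2) / 1 = √2 := by
    rw [Real.sqrt_div zero_le_one, Real.sqrt_one, div_one, mul_one_div, Real.div_sqrt]
  rw [hlim] at h3
  refine h3.congr fun y => ?_
  have hs : √(Real.exp (-(2 * y))) = Real.exp (-y) := by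
    rw [Real.sqrt_eq_iff_mul_self_eq (Real.exp_pos _).le (Real.exp_pos _).le, ← Real.exp_add]
    congr 1; ring
  have hd : Real.exp (2 * y) - Real.exp (-(a * y)) =
      Real.exp (2 * y) * (1 - Real.exp (-((a + 2) * y))) := by
    rw [mul_sub, mul_one, ← Real.exp_add]; congr 2; ring
  have h2y : Real.exp (2 * y) = Real.exp y * Real.exp y := by rw [← Real.exp_add]; congr 1; ring
  simp only [Pi.div_apply]
  rw [Real.sqrt_mul' _ (Real.exp_pos _).le, hs, hd, h2y, Real.exp_neg]
  have := Real.exp_pos y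
  field_simp

/-- This is `dx/dh` on the left branch, where `h = -√W` and `W' < 0`; both signs are absorbed in the
denominator. With `logRepulsion_le`, the quotient is at most `2 √(-y e^((a+2)y)) / (1 -
e^((a+2)y))`. -/
theorem tendsto_velocity_atBot (ha : 0 ≤ a) :
    Tendsto (fun y => Real.exp y * (2 * √(logPotential a y)) /
      (Real.exp (-(a * y)) - Real.exp (2 * y))) atBot (𝓝 0) := by
  have hc : 0 < a + 2 := by linarith
  have h1 : Tendsto (fun y : ℝ => 2 * √(-y * Real.exp ((a + 2) * y)) /
      (1 - Real.exp ((a + 2) * y))) atBot (𝓝 0) := by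
    have hm := (tendsto_mul_exp_neg_mul_atTop hc).comp tendsto_neg_atBot_atTop
    have he := (tendsto_exp_neg_mul_atTop hc).comp tendsto_neg_atBot_atTop
    have := (hm.sqrt.const_mul 2).div (he.const_sub 1) (by norm_num)
    simpa [Function.comp_def, Pi.div_def] using this
  refine tendsto_of_tendsto_of_tendsto_of_le_of_le' tendsto_const_nhds h1 ?_ ?_
  · filter_upwards [eventually_lt_atBot 0] with y hy
    have : Real.exp (2 * y) < Real.exp (-(a * y)) := Real.exp_lt_exp.2 (by nlinarith)
    exact div_nonneg (by positivity) (by linarith)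
  · filter_upwards [eventually_lt_atBot 0] with y hy
    have hlt : Real.exp ((a + 2) * y) < 1 := Real.exp_lt_one_iff.2 (by nlinarith)
    have hW : logPotential a y ≤ -y * Real.exp (-(a * y)) := by
      have := Real.exp_le_one_iff.2 (by linarith : 2 * y ≤ 0)
      rw [logPotential]; linarith [logRepulsion_le ha y]
    have hd : Real.exp (-(a * y)) - Real.exp (2 * y) =
        Real.exp (-(a * y)) * (1 - Real.exp ((a + 2) * y)) := by
      rw [mul_sub, mul_one, ← Real.exp_add]; congr 2; ring
    have hkey : Real.exp y * √(logPotential a y) ≤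
        Real.exp (-(a * y)) * √(-y * Real.exp ((a + 2) * y)) := by
      have e1 : Real.exp y = √(Real.exp (2 * y)) := by
        rw [eq_comm, Real.sqrt_eq_iff_mul_self_eq (Real.exp_pos _).le (Real.exp_pos _).le,
          ← Real.exp_add]
        congr 1; ring
      have e2 : Real.exp (-(a * y)) = √(Real.exp (-(2 * a * y))) := by
        rw [eq_comm, Real.sqrt_eq_iff_mul_self_eq (Real.exp_pos _).le (Real.exp_pos _).le,
          ← Real.exp_add]
        congr 1; ring
      have e3 : Real.exp (2 * y) * Real.exp (-(a * y)) =
          Real.exp (-(2 * a * y)) * Real.exp ((a + 2) * y) := by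
        rw [← Real.exp_add, ← Real.exp_add]; congr 1; ring
      rw [e1, ← Real.sqrt_mul (Real.exp_pos _).le, e2, ← Real.sqrt_mul (Real.exp_pos _).le]
      refine Real.sqrt_le_sqrt ?_
      calc _ ≤ Real.exp (2 * y) * (-y * Real.exp (-(a * y))) := by gcongr
        _ = -y * (Real.exp (2 * y) * Real.exp (-(a * y))) := by ring
        _ = _ := by rw [e3]; ring
    rw [hd, div_le_div_iff₀ (mul_pos (Real.exp_pos _) (by linarith)) (by linarith)]
    nlinarith [mul_le_mul_of_nonneg_right hkey (by linarith : 0 ≤ 1 - Real.exp ((a + 2) * y))]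

/-- The half-line is parametrized analytically by the signed square root `h` of the potential. -/
theorem exists_analytic_parametrization (ha : 0 ≤ a) :
    ∃ X X' : ℝ → ℝ, (∀ h, HasDerivAt X (X' h) h) ∧ (∀ h, AnalyticAt ℝ X' h) ∧ (∀ h, 0 < X' h) ∧
      (∀ h, 0 < X h) ∧ (∀ x, 0 < x → ∃ h, X h = x) ∧
      (∀ h, logPotential a (Real.log (X h)) = h ^ 2) ∧ (a + 2) * X' 0 ^ 2 = 2 ∧
      Tendsto X' atTop (𝓝 √2) ∧ Tendsto X' atBot (𝓝 0) := by
  have hk : HasDerivAt (fun y => Real.exp (2 * y) - Real.exp (-(a * y))) (a + 2) 0 := by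
    have h := (((hasDerivAt_id' (0 : ℝ)).const_mul 2).exp).fun_sub
      (((hasDerivAt_id' (0 : ℝ)).const_mul a).fun_neg.exp)
    refine h.congr_deriv ?_
    simp; ring
  obtain ⟨H, hHa, hHsq, hHpos, hH0', hH0⟩ := exists_analytic_sqrt (analyticAt_logPotential a)
    (hasDerivAt_logPotential a) (by simp [logPotential, logRepulsion])
    (fun y => mul_deriv_logPotential_pos ha) (fun y => logPotential_pos ha) hk (by linarith)
  have hmono : StrictMono H := strictMono_of_deriv_pos hHpos
  have hHr : ∀ y, 0 < y → H y = √(logPotential a y) := fun y hy => by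
    rw [← hHsq, Real.sqrt_sq (hH0 ▸ hmono hy).le]
  have hHl : ∀ y, y < 0 → H y = -√(logPotential a y) := fun y hy => by
    rw [← hHsq, Real.sqrt_sq_eq_abs, abs_of_neg (hH0 ▸ hmono hy), neg_neg]
  have htop : Tendsto H atTop atTop := by
    refine (Real.tendsto_sqrt_atTop.comp (tendsto_logPotential_atTop ha)).congr' ?_
    filter_upwards [eventually_gt_atTop 0] with y hy using (hHr y hy).symm
  have hbot : Tendsto H atBot atBot := by
    refine (tendsto_neg_atTop_atBot.comp
      (Real.tendsto_sqrt_atTop.comp (tendsto_logPotential_atBot ha))).congr' ?_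
    filter_upwards [eventually_lt_atBot 0] with y hy using (hHl y hy).symm
  obtain ⟨e, he, hea, hed⟩ := exists_analytic_inverse hHa hHpos htop hbot
  -- Differentiating `H² = W` identifies `1 / H'` with `2 H / W'` away from the minimum, which links
  -- `X'` to the two velocity limits.
  have hHH' : ∀ y, 2 * H y * deriv H y = Real.exp (2 * y) - Real.exp (-(a * y)) := fun y => by
    have h1 : HasDerivAt (logPotential a) (2 * H y * deriv H y) y := by
      rw [show logPotential a = fun y => H y ^ 2 from funext fun y => (hHsq y).symm]
      simpa using (hHa y).differentiableAt.hasDerivAt.fun_pow 2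
    exact h1.unique (hasDerivAt_logPotential a y)
  have hvel : ∀ y, y ≠ 0 → Real.exp y * (deriv H y)⁻¹ =
      Real.exp y * (2 * H y) / (Real.exp (2 * y) - Real.exp (-(a * y))) := fun y hy => by
    have h1 : H y ≠ 0 := fun h => hy (hmono.injective (h.trans hH0.symm))
    have h2 := (hHpos y).ne'
    rw [← hHH']
    field_simp
  have he0 : e.symm 0 = 0 := by rw [e.symm_apply_eq, he, hH0]
  refine ⟨fun h => Real.exp (e.symm h), fun h => Real.exp (e.symm h) * (deriv H (e.symm h))⁻¹,
    fun h => (hed h).exp, fun h => ?_, fun h => mul_pos (Real.exp_pos _) (inv_pos.2 (hHpos _)),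
    fun h => Real.exp_pos _, fun x hx => ⟨e (Real.log x), ?_⟩, fun h => ?_, ?_, ?_, ?_⟩
  · have h1 : AnalyticAt ℝ (fun h => deriv H (e.symm h)) h := (hHa _).deriv.comp (hea h)
    exact (hea h).rexp.mul (h1.inv (hHpos _).ne')
  · simp [Real.exp_log hx]
  · rw [Real.log_exp, ← hHsq, ← he, e.apply_symm_apply]
  · have := (hHpos 0).ne'
    simp only [he0, Real.exp_zero, one_mul]
    rw [← hH0']
    field_simp
  · have h1 : Tendsto (fun y => Real.exp y * (deriv H y)⁻¹) atTop (𝓝 √2) := by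
      refine (tendsto_velocity_atTop ha).congr' ?_
      filter_upwards [eventually_gt_atTop 0] with y hy
      rw [hvel y hy.ne', hHr y hy]
    exact h1.comp e.symm.tendsto_atTop
  · have h1 : Tendsto (fun y => Real.exp y * (deriv H y)⁻¹) atBot (𝓝 0) := by
      refine (tendsto_velocity_atBot ha).congr' ?_
      filter_upwards [eventually_lt_atBot 0] with y hy
      rw [hvel y hy.ne, hHl y hy, ← neg_sub (Real.exp (2 * y)), div_neg, mul_neg, mul_neg, neg_div]
    exact h1.comp e.symm.tendsto_atBot

end LogPotential

/-! ### The period in dimension four and in the other dimensions -/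

theorem potential_eq_logPotential (d : ℕ) {x : ℝ} (hx : 0 < x) :
    potential d x = logPotential ((d : ℝ) - 2) (Real.log x) := by
  rw [← potential_exp, Real.exp_log hx]

/-- In dimension four the period is constant. -/
theorem period_potential_four {E : ℝ} (hE : 0 < E) : period (potential 4) (Ioi 0) E = Real.pi := by
  -- Solving `2 sinh² (ln x) = h²` with the sign of `h` gives this `X`.
  let X : ℝ → ℝ := fun h => Real.exp (Real.arsinh (h / √2))
  let X' : ℝ → ℝ := fun h => X h * ((√(1 + (h / √2) ^ 2))⁻¹ * (1 / √2))
  have hX : ∀ h, HasDerivAt X (X' h) h := fun h =>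
    ((Real.hasDerivAt_arsinh _).comp h ((hasDerivAt_id' h).div_const (√2))).exp
  have hsq : ∀ u : ℝ, 0 < √(1 + u ^ 2) := fun u => Real.sqrt_pos.2 (by positivity)
  have hX' : Continuous X' := by
    have : Continuous X := continuous_iff_continuousAt.2 fun h => (hX h).continuousAt
    exact this.mul (((by fun_prop : Continuous fun h : ℝ => √(1 + (h / √2) ^ 2)).inv₀
      fun h => (hsq _).ne').mul continuous_const)
  -- With `u = h/√2`, `X = u + √(1 + u²)`, so `X'` is a constant plus an odd function of `h`.
  have hX'e : ∀ h, X' h = (√2)⁻¹ + (√2)⁻¹ * (h / √2 * (√(1 + (h / √2) ^ 2))⁻¹) := fun h => by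
    have := hsq (h / √2)
    simp only [X', X, Real.exp_arsinh]
    field_simp
    ring
  have hVX : ∀ h, potential 4 (X h) = h ^ 2 := fun h => by
    have h4 : logPotential ((4 : ℕ) - 2 : ℝ) (Real.arsinh (h / √2)) =
        2 * Real.sinh (Real.arsinh (h / √2)) ^ 2 := by
      have e1 : Real.exp (2 * Real.arsinh (h / √2)) = Real.exp (Real.arsinh (h / √2)) ^ 2 := by
        rw [← Real.exp_nat_mul]; norm_num
      have e2 : Real.exp (-(2 * Real.arsinh (h / √2))) =
          Real.exp (-Real.arsinh (h / √2)) ^ 2 := by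
        rw [← Real.exp_nat_mul]; congr 1; push_cast; ring
      have e3 : Real.exp (Real.arsinh (h / √2)) * Real.exp (-Real.arsinh (h / √2)) = 1 := by
        rw [← Real.exp_add]; simp
      have e4 : ((4 : ℕ) - 2 : ℝ) = 2 := by norm_num
      rw [logPotential, logRepulsion, e4, if_neg two_ne_zero, e1, e2, Real.sinh_eq]
      linear_combination e3
    rw [potential_exp, h4, Real.sinh_arsinh, div_pow, Real.sq_sqrt zero_le_two]
    ring
  have hper := period_eq_of_parametrization (V := potential 4) (D := Ioi 0) hVX
    (fun h => Real.exp_pos _)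
    (fun x hx => ⟨√2 * Real.sinh (Real.log x), by
      simp only [X]
      rw [mul_div_cancel_left₀ _ (by positivity), Real.arsinh_sinh, Real.exp_log hx]⟩)
    hX hX' (fun h => mul_pos (Real.exp_pos _) (mul_pos (inv_pos.2 (hsq _)) (by positivity)))
    (Real.sqrt_pos.2 hE)
  rw [Real.sq_sqrt hE.le] at hper
  set r := √E
  let q : ℝ → ℝ := fun θ =>
    (√2)⁻¹ * (r * Real.sin θ / √2 * (√(1 + (r * Real.sin θ / √2) ^ 2))⁻¹)
  have hq : Continuous q := by
    have : Continuous fun θ => (√(1 + (r * Real.sin θ / √2) ^ 2))⁻¹ :=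
      (by fun_prop : Continuous fun θ => √(1 + (r * Real.sin θ / √2) ^ 2)).inv₀
        fun θ => (hsq _).ne'
    fun_prop
  have hqodd : ∫ θ in -(Real.pi / 2)..Real.pi / 2, q θ = 0 := by
    have h1 : ∫ θ in -(Real.pi / 2)..Real.pi / 2, q (-θ) =
        ∫ θ in -(Real.pi / 2)..Real.pi / 2, q θ := by
      rw [intervalIntegral.integral_comp_neg, neg_neg]
    have h2 : ∀ θ, q (-θ) = -q θ := fun θ => by
      simp only [q, Real.sin_neg, mul_neg, neg_div, neg_sq, neg_mul]
    simp only [h2, intervalIntegral.integral_neg] at h1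
    linarith
  rw [hper, intervalIntegral.integral_congr (g := fun θ => (√2)⁻¹ + q θ) fun θ _ => hX'e _,
    intervalIntegral.integral_add (by simp) (hq.intervalIntegrable _ _), hqodd,
    intervalIntegral.integral_const, smul_eq_mul]
  field_simp
  ring

theorem nonconstantOnSubintervals_period_potential {d : ℕ} (hd : 2 ≤ d) (hd4 : d ≠ 4) :
    NonconstantOnSubintervals (period (potential d) (Ioi 0)) (Ioi 0) := by
  have ha : (0 : ℝ) ≤ (d : ℝ) - 2 := sub_nonneg.2 (by exact_mod_cast hd)
  obtain ⟨X, X', hX, hX'a, hX'pos, hXpos, hsurj, hVX, hX'0, htop, hbot⟩ :=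
    exists_analytic_parametrization ha
  have hVX' : ∀ h, potential d (X h) = h ^ 2 := fun h => by
    rw [potential_eq_logPotential d (hXpos h), hVX]
  have hX'c : Continuous X' := continuous_iff_continuousAt.2 fun h => (hX'a h).continuousAt
  let G : ℝ → ℝ := fun r => ∫ θ in -(Real.pi / 2)..Real.pi / 2, X' (r * Real.sin θ)
  have hG : ∀ r, AnalyticAt ℝ G r := fun r =>
    analyticAt_integral_comp_mul hX'a Real.continuous_sin (by linarith [Real.pi_pos]) r
  have hper : ∀ r, 0 < r → period (potential d) (Ioi 0) (r ^ 2) = √2 * G r := fun r hr =>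
    period_eq_of_parametrization hVX' hXpos hsurj hX hX'c hX'pos hr
  intro I hI hIc hIn
  by_contra! hconst
  obtain ⟨E₁, hE₁, E₂, hE₂, hlt⟩ := hIn.exists_lt
  have h1 : 0 < E₁ := hI hE₁
  -- Near `m` the squares `r²` stay between `E₁` and `E₂`, hence in `I`, so `G` is locally constant
  -- there.
  obtain ⟨m, hm1, hm2⟩ := exists_between (Real.sqrt_lt_sqrt h1.le hlt)
  set T₁ := period (potential d) (Ioi 0) E₁
  have hev : G =ᶠ[𝓝 m] fun _ => T₁ / √2 := by
    filter_upwards [Ioo_mem_nhds hm1 hm2] with r hr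
    have hr0 : 0 < r := (Real.sqrt_nonneg _).trans_lt hr.1
    have hmem : r ^ 2 ∈ I := hIc.out hE₁ hE₂
      ⟨(Real.sqrt_le_left hr0.le).1 hr.1.le, ((Real.lt_sqrt hr0.le).1 hr.2).le⟩
    rw [eq_div_iff (by positivity), mul_comm, ← hper r hr0]
    exact hconst _ hmem _ hE₁
  -- The identity theorem on the whole line reaches `r = 0`, where `G` has a value although no orbit
  -- has energy `0` in the range considered.
  have hGc : G = fun _ => T₁ / √2 := AnalyticOnNhd.eq_of_eventuallyEq (z₀ := m)
    (fun r _ => hG r) (fun r _ => analyticAt_const) hev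
  have hG0 : G 0 = Real.pi * X' 0 := by
    simp only [G, zero_mul, intervalIntegral.integral_const, smul_eq_mul]
    ring
  have hlim : Tendsto G atTop (𝓝 (Real.pi / 2 * (√2 + 0))) :=
    tendsto_integral_comp_mul_sin hX'c htop hbot
  have heq : Real.pi * X' 0 = Real.pi / 2 * (√2 + 0) := by
    have h2 : Tendsto G atTop (𝓝 (T₁ / √2)) := by rw [hGc]; exact tendsto_const_nhds
    rw [← hG0, tendsto_nhds_unique hlim h2, hGc]
  have hX0 : X' 0 = √2 / 2 := by
    have := Real.pi_pos
    field_simp at heq ⊢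
    linarith
  -- The relation `(a + 2) X'(0)² = 2` with `a + 2 = d` and `X'(0)² = 1/2` reads `d = 4`.
  rw [hX0, div_pow, Real.sq_sqrt zero_le_two] at hX'0
  have : (d : ℝ) = 4 := by linarith
  exact hd4 (by exact_mod_cast this)

theorem corollary3p5 (d : ℕ) (hd : 2 ≤ d) :
    -- the period is well defined: exactly two turning points, and a convergent integral
    (∀ E : ℝ, 0 < E →
      leftTurningPoint (potential d) (Ioi 0) E < rightTurningPoint (potential d) (Ioi 0) E ∧
      turningPoints (potential d) (Ioi 0) E =
        {leftTurningPoint (potential d) (Ioi 0) E, rightTurningPoint (potential d) (Ioi 0) E} ∧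
      IntervalIntegrable (fun x => 1 / Real.sqrt (2 * (E - potential d x))) volume
        (leftTurningPoint (potential d) (Ioi 0) E) (rightTurningPoint (potential d) (Ioi 0) E)) ∧
    (NonconstantOnSubintervals (period (potential d) (Ioi 0)) (Ioi 0) ↔ d ≠ 4) ∧
    (d = 4 → ∀ E : ℝ, 0 < E → period (potential d) (Ioi 0) E = Real.pi) := by
  have h4 : d = 4 → ∀ E : ℝ, 0 < E → period (potential d) (Ioi 0) E = Real.pi := by
    rintro rfl E hE
    exact period_potential_four hE
  refine ⟨fun E hE => ?_, ⟨fun hn hd4 => ?_, nonconstantOnSubintervals_period_potential hd⟩, h4⟩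
  · have ha : (0 : ℝ) ≤ (d : ℝ) - 2 := sub_nonneg.2 (by exact_mod_cast hd)
    obtain ⟨X, X', hX, hX'a, hX'pos, hXpos, hsurj, hVX, -⟩ := exists_analytic_parametrization ha
    have hVX' : ∀ h, potential d (X h) = h ^ 2 := fun h => by
      rw [potential_eq_logPotential d (hXpos h), hVX]
    have hmono : StrictMono X :=
      strictMono_of_deriv_pos fun h => by rw [(hX h).deriv]; exact hX'pos h
    obtain ⟨r, hr, rfl⟩ : ∃ r, 0 < r ∧ E = r ^ 2 :=
      ⟨√E, Real.sqrt_pos.2 hE, (Real.sq_sqrt hE.le).symm⟩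
    rw [leftTurningPoint_eq_of_parametrization (D := Ioi 0) hVX' hXpos hsurj hmono hr,
      rightTurningPoint_eq_of_parametrization (D := Ioi 0) hVX' hXpos hsurj hmono hr]
    exact ⟨hmono (by linarith), turningPoints_eq_of_parametrization hVX' hXpos hsurj,
      (integral_period_of_parametrization hVX' hX
        (continuous_iff_continuousAt.2 fun h => (hX'a h).continuousAt) hX'pos hr).1⟩
  · obtain ⟨E₁, h1, E₂, h2, hne⟩ := hn (Ioi 0) subset_rfl ordConnected_Ioi
      ⟨1, mem_Ioi.2 one_pos, 2, mem_Ioi.2 two_pos, by norm_num⟩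
    exact hne ((h4 hd4 E₁ h1).trans (h4 hd4 E₂ h2).symm)
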